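/- Let $\mathbb R_+=(0,\infty)$ and $\mathbb N=\{1,2,\dots\}$. Let $\mu$ be a probability measure on $\mathbb R_+^{\mathbb N}\times\mathbb R_+^{\mathbb N}$, the distribution of a pair of random sequences $(\mathbf a,\mathbf b)=((a_i)_{i\in\mathbb N},(b_j)_{j\in\mathbb N})$. For $k\in\mathbb N$ let $\tau_k$ be the shift $(c_n)_n\mapsto(c_{n+k})_n$, and assume that for all $k,l\in\mathbb N$ the map $\tau_k\times\tau_l$ preserves $\mu$ and is ergodic (every Borel set $B$ with $(\tau_k\times\tau_l)^{-1}(B)=B$ has $\mu(B)\in\{0,1\}$). Assume further that $\mathbb E[a_1+b_1]<\infty$ and $\operatorname{ess\,inf} a_1+\operatorname{ess\,inf} b_1>0$, where $\mathbb E$ and $\operatorname{ess\,inf}$ refer to $\mu$. Given $(\mathbf a,\mathbf b)$, let $\mathbf P_{\mathbf a,\mathbf b}$ (the quenched measure) be the probability measure under which the weights $W(i,j)$, $i,j\in\mathbb N$, are independent and $W(i,j)$ is exponentially distributed with rate $a_i+b_j$, i.e. $\mathbf P_{\mathbf a,\mathbf b}(W(i,j)\ge x)=e^{-(a_i+b_j)x}$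 for $x\ge 0$. Define the last-passage times by $G(i,0)=G(0,j)=0$ and $G(i,j)=\max\{G(i-1,j),G(i,j-1)\}+W(i,j)$ for $i,j\in\mathbb N$. Let $g$ be the shape function of the model: for all $s,t>0$, $g(s,t)$ is the (existing, uniquely determined) deterministic real number such that, for $\mu$-almost every $(\mathbf a,\mathbf b)$, $n^{-1}G(\lfloor ns\rfloor,\lfloor nt\rfloor)\to g(s,t)$ as $n\to\infty$, $\mathbf P_{\mathbf a,\mathbf b}$-almost surely. Then, for $\mu$-almost every $(\mathbf a,\mathbf b)$, simultaneously for all $s,t>0$ and all real $r<g(s,t)$, $$\lim_{n\to\infty}-\frac1n\log \mathbf P_{\mathbf a,\mathbf b}\bigl(G(\lfloor ns\rfloor,\lfloor nt\rfloor)\le nr\bigr)=\infty,$$ with the convention $\log 0=-\infty$. -/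

import Mathlib

open MeasureTheory ProbabilityTheory Filter Topology

noncomputable section

namespace CornerGrowth

/-- Sequences with values in `(0, ∞)`. All sequences and arrays are indexed from `0`: the entry
with index `i` is the entry that is traditionally numbered `i + 1`. -/
abbrev PosSeq : Type := ℕ → Set.Ioi (0 : ℝ)

/-- The shift by `k`, sending `(c_n)` to `(c_{n+k})`. -/
def shift (k : ℕ) (c : PosSeq) : PosSeq := fun n => c (n + k)

instance instIsProbabilityMeasureExp (x y : Set.Ioi (0 : ℝ)) :
    IsProbabilityMeasure (expMeasure ((x : ℝ) + (y : ℝ))) :=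
  isProbabilityMeasure_expMeasure (add_pos x.2 y.2)

/-- The quenched measure for the parameters `p = (a, b)`: the law of an array of independent
weights whose `(i, j)` entry is exponentially distributed with rate `a i + b j`. -/
def quenched (p : PosSeq × PosSeq) : Measure (ℕ × ℕ → ℝ) :=
  Measure.infinitePi fun ij : ℕ × ℕ => expMeasure ((p.1 ij.1 : ℝ) + (p.2 ij.2 : ℝ))

/-- The last-passage times `G(m, n)` of the weights `w`: they vanish if `m = 0` or `n = 0`, and
`G(m, n) = max (G(m - 1, n)) (G(m, n - 1)) + W(m, n)` for `m, n ≥ 1`, where `W(m, n)` is the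
entry `w (m - 1, n - 1)` in the indexing from `0`. -/
def lastPassage (w : ℕ × ℕ → ℝ) : ℕ → ℕ → ℝ
  | 0, _ => 0
  | _ + 1, 0 => 0
  | m + 1, n + 1 => max (lastPassage w m (n + 1)) (lastPassage w (m + 1) n) + w (m, n)

/-- `g` is the shape function of the model with parameters drawn from `μ`: for all `s, t > 0`,
the deterministic number `g s t` is the almost sure limit of `G(⌊ns⌋, ⌊nt⌋) / n`. This determines
`g s t` uniquely for `s, t > 0` (when `μ` is a probability measure). -/
def IsShapeFunction (μ : Measure (PosSeq × PosSeq)) (g : ℝ → ℝ → ℝ) : Prop :=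
  ∀ s t : ℝ, 0 < s → 0 < t → ∀ᵐ p ∂μ, ∀ᵐ w ∂(quenched p),
    Tendsto (fun n : ℕ => lastPassage w ⌊(n : ℝ) * s⌋₊ ⌊(n : ℝ) * t⌋₊ / (n : ℝ)) atTop
      (𝓝 (g s t))

end CornerGrowth

end

/-!
All quenched measures are realized on one space by the weights `|E i j| / (a i + b j)`, with a
single array `E` of independent exponential variables of rate `1`.

A last-passage time dominates the sum of the last-passage times across a diagonal chain of `N`
blocks. For almost every `(a, b)`, Birkhoff's theorem applied to the Laplace transforms of the
blocks bounds by `exp (-δN)` the probability that such a sum stays below `N` times a number smaller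
than the mean of a block. The blocks of `L` neighbouring chains are disjoint, hence independent, so
all these sums are small with probability at most `exp (-LδN)`, while fitting all the chains in
lengthens the rectangle by only `L` blocks. Since `L` is arbitrary, the lower tail decays faster
than exponentially below the supremum of the normalized means.

By Borel-Cantelli this supremum is an almost sure lower bound for the growth rate. It is also an
upper bound: the maximal inequality behind Kingman's theorem only asks for invariance of the joint
law of `(a, b)` and `E`, and the lower bound takes the place of the zero-one law. The means grow
linearly because `a i + b j` is bounded away from `0`: replacing each maximum in the recursion by
a sum bounds the exponential moments of `G(m, n)` geometrically in `m + n`.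
-/

noncomputable section Ergodic

variable {Ω : Type*} {T : Ω → Ω}

/-- `X` is a nonnegative superadditive process over the map `T`: the contribution of the times
after `m` is measured along the orbit of `T^[m] ω`. -/
structure IsNonnegSuperadditive (T : Ω → Ω) (X : ℕ → Ω → ℝ) : Prop where
  nonneg : ∀ n ω, 0 ≤ X n ω
  add_le : ∀ m n ω, X m ω + X n (T^[m] ω) ≤ X (m + n) ω

/-- The upper growth rate `limsup X n / n` of a process, as an extended real number so that it is
meaningful for unbounded processes too. -/
def upperRate (X : ℕ → Ω → ℝ) (ω : Ω) : EReal :=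
  limsup (fun n : ℕ => ((X n ω / n : ℝ) : EReal)) atTop

namespace IsNonnegSuperadditive

variable {X Y : ℕ → Ω → ℝ}

theorem add (hX : IsNonnegSuperadditive T X) (hY : IsNonnegSuperadditive T Y) :
    IsNonnegSuperadditive T (X + Y) where
  nonneg n ω := add_nonneg (hX.nonneg n ω) (hY.nonneg n ω)
  add_le m n ω := by
    simpa only [Pi.add_apply, add_add_add_comm] using
      add_le_add (hX.add_le m n ω) (hY.add_le m n ω)

theorem of_birkhoffSum {f : Ω → ℝ} (hf : ∀ ω, 0 ≤ f ω) :
    IsNonnegSuperadditive T (birkhoffSum T f) where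
  nonneg _ _ := Finset.sum_nonneg fun _ _ => hf _
  add_le m n ω := (birkhoffSum_add T f m n ω).ge

/-- The proof covers `[0, n)` greedily by intervals along which the process grows at rate `c`. -/
theorem mul_le_add_of_forall_exists_mul_le (hX : IsNonnegSuperadditive T X) {c : ℝ} {M : ℕ} {ω : Ω}
    (h : ∀ k, ∃ j, 0 < j ∧ j ≤ M ∧ j * c ≤ X j (T^[k] ω)) (n : ℕ) :
    n * c ≤ X n ω + M * |c| := by
  induction n using Nat.strong_induction_on generalizing ω with
  | _ n ih =>
  rcases le_or_gt n M with hn | hn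
  · calc n * c ≤ n * |c| := by gcongr; exact le_abs_self c
      _ ≤ M * |c| := by gcongr
      _ ≤ X n ω + M * |c| := le_add_of_nonneg_left (hX.nonneg n ω)
  · obtain ⟨j, hj, hjM, hjX⟩ := h 0
    have h_rest : (n - j : ℕ) * c ≤ X (n - j) (T^[j] ω) + M * |c| := by
      refine ih (n - j) (by omega) fun k => ?_
      simpa only [Function.iterate_add_apply] using h (k + j)
    have h_split := hX.add_le j (n - j) ω
    rw [Nat.add_sub_cancel' (by omega)] at h_split
    rw [Nat.cast_sub (by omega)] at h_rest
    rw [Function.iterate_zero_apply] at hjX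
    linarith

theorem upperRate_comp_le (hX : IsNonnegSuperadditive T X) (ω : Ω) :
    upperRate X (T ω) ≤ upperRate X ω := by
  refine EReal.ge_of_forall_gt_iff_ge.1 fun c hc => ?_
  obtain ⟨d, hcd, hd⟩ := EReal.lt_iff_exists_real_btwn.1 hc
  have h_gap : ∀ᶠ n : ℕ in atTop, c ≤ n * (d - c) :=
    (tendsto_natCast_atTop_atTop.atTop_mul_const
      (sub_pos.2 (EReal.coe_lt_coe_iff.1 hcd))).eventually_ge_atTop c
  have h_freq : ∃ᶠ n : ℕ in atTop,
      (c : EReal) ≤ ((X (n + 1) ω / (n + 1 : ℕ) : ℝ) : EReal) := by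
    refine ((frequently_lt_of_lt_limsup (by isBoundedDefault) hd).and_eventually
      (h_gap.and (eventually_gt_atTop 0))).mono ?_
    rintro n ⟨hdn, hcn, hn⟩
    rw [EReal.coe_lt_coe_iff, lt_div_iff₀ (by positivity)] at hdn
    rw [EReal.coe_le_coe_iff, le_div_iff₀ (by positivity)]
    have h_split := hX.add_le 1 n ω
    rw [Function.iterate_one, add_comm 1 n] at h_split
    push_cast
    linarith [hX.nonneg 1 ω]
  exact le_limsup_of_frequently_le
    ((tendsto_add_atTop_nat 1).frequently (p := fun n : ℕ => (c : EReal) ≤ (X n ω / n : ℝ)) h_freq)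
    (by isBoundedDefault)

end IsNonnegSuperadditive

theorem exists_mul_le_of_lt_upperRate {X : ℕ → Ω → ℝ} {c : ℝ} {ω : Ω} (h : c < upperRate X ω) :
    ∃ n : ℕ, 0 < n ∧ n * c ≤ X n ω := by
  obtain ⟨n, hcn, hn⟩ := ((frequently_lt_of_lt_limsup (by isBoundedDefault) h).and_eventually
    (eventually_gt_atTop 0)).exists
  rw [EReal.coe_lt_coe_iff, lt_div_iff₀' (by positivity)] at hcn
  exact ⟨n, hn, hcn.le⟩

theorem eventually_lt_mul_of_upperRate_lt {X : ℕ → Ω → ℝ} {c : ℝ} {ω : Ω}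
    (h : upperRate X ω < c) : ∀ᶠ n : ℕ in atTop, X n ω < n * c := by
  filter_upwards [eventually_lt_of_limsup_lt h, eventually_gt_atTop 0] with n hcn hn
  rwa [EReal.coe_lt_coe_iff, div_lt_iff₀' (by positivity)] at hcn

/-- The set of points at which `X` reaches the rate `v` by time `M`. -/
def reachSet (X : ℕ → Ω → ℝ) (v : Ω → ℝ) (M : ℕ) : Set Ω :=
  {ω | ∃ j, 0 < j ∧ j ≤ M ∧ j * v ω ≤ X j ω}

theorem monotone_reachSet (X : ℕ → Ω → ℝ) (v : Ω → ℝ) : Monotone (reachSet X v) :=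
  fun _ _ h _ ⟨j, hj, hjM, hjX⟩ => ⟨j, hj, hjM.trans h, hjX⟩

variable [MeasurableSpace Ω] {P : Measure Ω} {X : ℕ → Ω → ℝ}

theorem measurable_upperRate (hX : ∀ n, Measurable (X n)) : Measurable (upperRate X) :=
  Measurable.limsup fun n => ((hX n).div_const _).coe_real_ereal

theorem ae_upperRate_le_of_forall_measure_eq_zero {Γ : ℝ}
    (h : ∀ c : ℝ, Γ < c → P {ω | c < upperRate X ω} = 0) : ∀ᵐ ω ∂P, upperRate X ω ≤ Γ := by
  have h_rat : ∀ᵐ ω ∂P, ∀ c : ℚ, Γ < c → upperRate X ω ≤ (c : ℝ) := by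
    simp only [ae_all_iff]
    intro c hc
    filter_upwards [measure_eq_zero_iff_ae_notMem.1 (h c hc)] with ω hω using not_lt.1 hω
  filter_upwards [h_rat] with ω hω
  refine EReal.le_of_forall_lt_iff_le.1 fun c hc => ?_
  obtain ⟨d, hΓd, hdc⟩ := exists_rat_btwn (EReal.coe_lt_coe_iff.1 hc)
  exact (hω d hΓd).trans (EReal.coe_le_coe_iff.2 hdc.le)

theorem integrable_birkhoffSum (hT : MeasurePreserving T P P) {f : Ω → ℝ} (hf : Integrable f P)
    (n : ℕ) : Integrable (birkhoffSum T f n) P :=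
  integrable_finsetSum _ fun k _ => (hT.iterate k).integrable_comp_of_integrable hf

theorem integral_birkhoffSum (hT : MeasurePreserving T P P) {f : Ω → ℝ} (hf : Integrable f P)
    (n : ℕ) : ∫ ω, birkhoffSum T f n ω ∂P = n * ∫ ω, f ω ∂P := by
  have h_iterate (k : ℕ) : ∫ ω, f (T^[k] ω) ∂P = ∫ ω, f ω ∂P := by
    rw [← integral_map (hT.iterate k).aemeasurable
      (by rw [(hT.iterate k).map_eq]; exact hf.aestronglyMeasurable), (hT.iterate k).map_eq]
  have h_integrable (k : ℕ) : Integrable (fun ω => f (T^[k] ω)) P :=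
    (hT.iterate k).integrable_comp_of_integrable hf
  simp only [birkhoffSum]
  rw [integral_finsetSum _ fun k _ => h_integrable k]
  simp only [h_iterate, Finset.sum_const, Finset.card_range, nsmul_eq_mul]

theorem ae_forall_iterate_eq (hT : MeasurePreserving T P P) {E : Type*} {v : Ω → E}
    (hv : v ∘ T =ᵐ[P] v) : ∀ᵐ ω ∂P, ∀ k, v (T^[k] ω) = v ω := by
  rw [ae_all_iff]
  intro k
  induction k with
  | zero => exact .of_forall fun _ => rfl
  | succ k ih =>
    filter_upwards [ih, (hT.iterate k).quasiMeasurePreserving.ae hv] with ω h_prev h_step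
    rw [Function.iterate_succ_apply', ← h_prev]
    exact h_step

theorem measurableSet_reachSet (hX : ∀ n, Measurable (X n)) {v : Ω → ℝ} (hv : Measurable v)
    (M : ℕ) : MeasurableSet (reachSet X v M) := by
  simp only [reachSet, Set.ofPred_exists, Set.ofPred_and]
  exact .iUnion fun j => (MeasurableSet.const _).inter
    ((MeasurableSet.const _).inter (measurableSet_le (hv.const_mul _) (hX j)))

theorem tendsto_measureReal_compl_reachSet [IsFiniteMeasure P] (hX : ∀ n, Measurable (X n))
    {v : Ω → ℝ} (hv : Measurable v) (h : ∀ᵐ ω ∂P, ∃ n : ℕ, 0 < n ∧ n * v ω ≤ X n ω) :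
    Tendsto (fun M => P.real (reachSet X v M)ᶜ) atTop (𝓝 0) := by
  have h_null : P (⋂ M, (reachSet X v M)ᶜ) = 0 := by
    refine measure_eq_zero_iff_ae_notMem.2 ?_
    filter_upwards [h] with ω ⟨n, hn, hnX⟩ hω
    exact Set.mem_iInter.1 hω n ⟨n, hn, le_rfl, hnX⟩
  have h_lim := tendsto_measure_iInter_atTop (μ := P)
    (fun M => (measurableSet_reachSet hX hv M).compl.nullMeasurableSet)
    (fun _ _ hM => Set.compl_subset_compl.2 (monotone_reachSet X v hM)) ⟨0, measure_ne_top _ _⟩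
  rw [h_null] at h_lim
  exact (ENNReal.tendsto_toReal ENNReal.zero_ne_top).comp h_lim

namespace IsNonnegSuperadditive

variable [IsProbabilityMeasure P]

/-- Off the set where `X` reaches the rate `v` by time `M`, the process is topped up by `K`, so
that the covering argument applies everywhere. -/
theorem integral_le_add_measureReal_compl_reachSet (hX : IsNonnegSuperadditive T X)
    (hT : MeasurePreserving T P P) (hXm : ∀ n, Measurable (X n)) (hXi : ∀ n, Integrable (X n) P)
    {Γ : ℝ} (hΓ : ∀ n, ∫ ω, X n ω ∂P ≤ n * Γ) {v : Ω → ℝ} {K : ℝ} (hv : Measurable v)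
    (hvK : ∀ ω, |v ω| ≤ K) (hvT : v ∘ T =ᵐ[P] v) (M : ℕ) :
    ∫ ω, v ω ∂P ≤ Γ + P.real (reachSet X v M)ᶜ * K := by
  set topUp : Ω → ℝ := (reachSet X v M)ᶜ.indicator fun _ => K
  have h_compl := (measurableSet_reachSet hXm hv M).compl
  have h_topUp_nonneg : ∀ ω, 0 ≤ topUp ω := fun ω =>
    Set.indicator_nonneg (fun _ _ => (abs_nonneg _).trans (hvK ω)) ω
  have h_topUp : Integrable topUp P := (integrable_const K).indicator h_compl
  have h_vi : Integrable v P := .of_bound hv.aestronglyMeasurable K (.of_forall hvK)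
  have h_reach (ω : Ω) : ∃ j, 0 < j ∧ j ≤ M + 1 ∧ j * v ω ≤ (X + birkhoffSum T topUp) j ω := by
    by_cases hω : ω ∈ reachSet X v M
    · obtain ⟨j, hj, hjM, hjX⟩ := hω
      exact ⟨j, hj, by omega, hjX.trans
        (le_add_of_nonneg_right ((of_birkhoffSum h_topUp_nonneg).nonneg j ω))⟩
    · refine ⟨1, one_pos, by omega, ?_⟩
      have : topUp ω = K := Set.indicator_of_mem hω _
      simp only [Pi.add_apply, birkhoffSum_one, this, Nat.cast_one, one_mul]
      linarith [hX.nonneg 1 ω, (abs_le.1 (hvK ω)).2]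
  have h_pointwise (n : ℕ) :
      ∀ᵐ ω ∂P, n * v ω ≤ X n ω + birkhoffSum T topUp n ω + (M + 1 : ℕ) * K := by
    filter_upwards [ae_forall_iterate_eq hT hvT] with ω hω
    have h_cover := (hX.add (of_birkhoffSum h_topUp_nonneg)).mul_le_add_of_forall_exists_mul_le
      (fun k => by simpa only [hω k] using h_reach (T^[k] ω)) n
    exact h_cover.trans (by gcongr; exacts [le_rfl, hvK ω])
  have h_mean (n : ℕ) :
      n * ∫ ω, v ω ∂P ≤ n * (Γ + P.real (reachSet X v M)ᶜ * K) + (M + 1 : ℕ) * K := by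
    have h_sum := (hXi n).add (integrable_birkhoffSum hT h_topUp n)
    have h_int := integral_mono_ae (h_vi.const_mul n) (h_sum.add (integrable_const _))
      (h_pointwise n)
    rw [integral_const_mul, integral_add' h_sum (integrable_const _),
      integral_add' (hXi n) (integrable_birkhoffSum hT h_topUp n), integral_birkhoffSum hT h_topUp,
      integral_indicator_const K h_compl, integral_const, probReal_univ, one_smul,
      smul_eq_mul] at h_int
    linarith [hΓ n]
  by_contra! h_lt
  obtain ⟨n, hn⟩ := exists_nat_gt ((M + 1 : ℕ) * K / (∫ ω, v ω ∂P -
    (Γ + P.real (reachSet X v M)ᶜ * K)))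
  rw [div_lt_iff₀ (sub_pos.2 h_lt)] at hn
  linarith [h_mean n]

theorem integral_le_of_ae_exists_mul_le (hX : IsNonnegSuperadditive T X)
    (hT : MeasurePreserving T P P) (hXm : ∀ n, Measurable (X n)) (hXi : ∀ n, Integrable (X n) P)
    {Γ : ℝ} (hΓ : ∀ n, ∫ ω, X n ω ∂P ≤ n * Γ) {v : Ω → ℝ} {K : ℝ} (hv : Measurable v)
    (hvK : ∀ ω, |v ω| ≤ K) (hvT : v ∘ T =ᵐ[P] v)
    (hvX : ∀ᵐ ω ∂P, ∃ n : ℕ, 0 < n ∧ n * v ω ≤ X n ω) :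
    ∫ ω, v ω ∂P ≤ Γ := by
  have h_lim := ((tendsto_measureReal_compl_reachSet hXm hv hvX).mul_const K).const_add Γ
  rw [zero_mul, add_zero] at h_lim
  exact ge_of_tendsto' h_lim
    (hX.integral_le_add_measureReal_compl_reachSet hT hXm hXi hΓ hv hvK hvT)

theorem ae_upperRate_le_of_ergodic (hX : IsNonnegSuperadditive T X) (hT : Ergodic T P)
    (hXm : ∀ n, Measurable (X n)) (hXi : ∀ n, Integrable (X n) P) {Γ : ℝ}
    (hΓ : ∀ n, ∫ ω, X n ω ∂P ≤ n * Γ) : ∀ᵐ ω ∂P, upperRate X ω ≤ Γ := by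
  refine ae_upperRate_le_of_forall_measure_eq_zero fun c hc => ?_
  have h_meas : MeasurableSet {ω | c < upperRate X ω} :=
    measurableSet_lt measurable_const (measurable_upperRate hXm)
  rcases hT.ae_empty_or_univ_of_preimage_ae_le h_meas.nullMeasurableSet
    (.of_forall fun ω hω => lt_of_lt_of_le hω (hX.upperRate_comp_le ω)) with h_empty | h_univ
  · rw [measure_congr h_empty, measure_empty]
  · have h_le := hX.integral_le_of_ae_exists_mul_le hT.toMeasurePreserving hXm hXi hΓ
      (v := fun _ => c) measurable_const (fun _ => le_rfl) (.of_forall fun _ => rfl)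
      (by
        filter_upwards [h_univ.mem_iff] with ω hω
        exact exists_mul_le_of_lt_upperRate (hω.2 trivial))
    rw [integral_const, probReal_univ, one_smul] at h_le
    exact absurd h_le hc.not_ge

/-- Without ergodicity, an almost sure lower bound on the growth of the process that matches the
growth of its means replaces the zero-one law. -/
theorem ae_upperRate_le_of_forall_lt (hX : IsNonnegSuperadditive T X)
    (hT : MeasurePreserving T P P) (hXm : ∀ n, Measurable (X n)) (hXi : ∀ n, Integrable (X n) P)
    {Γ : ℝ} (hΓ : ∀ n, ∫ ω, X n ω ∂P ≤ n * Γ)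
    (h_lower : ∀ c < Γ, ∀ᵐ ω ∂P, ∃ n : ℕ, 0 < n ∧ n * c ≤ X n ω) :
    ∀ᵐ ω ∂P, upperRate X ω ≤ Γ := by
  classical
  refine ae_upperRate_le_of_forall_measure_eq_zero fun c hc => ?_
  set A := {ω | c < upperRate X ω}
  have h_meas : MeasurableSet A := measurableSet_lt measurable_const (measurable_upperRate hXm)
  have h_inv : T ⁻¹' A =ᵐ[P] A :=
    ae_eq_of_subset_of_measure_ge (fun ω hω => lt_of_lt_of_le hω (hX.upperRate_comp_le ω))
      (hT.measure_preimage h_meas.nullMeasurableSet).ge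
      (hT.measurable h_meas).nullMeasurableSet (measure_ne_top _ _)
  have h_mean (d : ℝ) (hd : d < Γ) : P.real A * c + (1 - P.real A) * d ≤ Γ := by
    have h_le := hX.integral_le_of_ae_exists_mul_le hT hXm hXi hΓ
      (v := A.piecewise (fun _ => c) (fun _ => d)) (K := max |c| |d|)
      (measurable_const.piecewise h_meas measurable_const)
      (fun ω => by by_cases hω : ω ∈ A <;> simp [hω])
      (by
        filter_upwards [h_inv.mem_iff] with ω hω
        simp only [Function.comp_apply, Set.piecewise, ← hω, Set.mem_preimage])
      (by
        filter_upwards [h_lower d hd] with ω hω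
        by_cases hωA : ω ∈ A
        · simpa [hωA] using exists_mul_le_of_lt_upperRate hωA
        · simpa [hωA] using hω)
    rw [integral_piecewise h_meas integrableOn_const integrableOn_const] at h_le
    simpa only [setIntegral_const, smul_eq_mul, measureReal_compl h_meas, probReal_univ] using h_le
  have h_limit : P.real A * c + (1 - P.real A) * Γ ≤ Γ := by
    refine le_of_forall_pos_le_add fun ε hε => ?_
    nlinarith [h_mean (Γ - ε) (by linarith), measureReal_nonneg (μ := P) (s := A)]
  have h_zero : P.real A = 0 := by nlinarith [measureReal_nonneg (μ := P) (s := A)]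
  exact (measureReal_eq_zero_iff).1 h_zero

end IsNonnegSuperadditive

/-- This is the upper bound on the rate of the nonnegative function `K - f`. -/
theorem ae_eventually_mul_lt_birkhoffSum [IsProbabilityMeasure P] (hT : Ergodic T P) {f : Ω → ℝ}
    (hf : Measurable f) (hfi : Integrable f P) {K : ℝ} (hfK : ∀ ω, f ω ≤ K) {η : ℝ}
    (hη : η < ∫ ω, f ω ∂P) : ∀ᵐ ω ∂P, ∀ᶠ n : ℕ in atTop, n * η < birkhoffSum T f n ω := by
  have hT' := hT.toMeasurePreserving
  have h_gap : Integrable (fun ω => K - f ω) P := (integrable_const K).sub hfi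
  have h_rate : ∀ᵐ ω ∂P, upperRate (birkhoffSum T fun ω => K - f ω) ω
      ≤ (K - ∫ ω, f ω ∂P : ℝ) := by
    refine (IsNonnegSuperadditive.of_birkhoffSum fun ω =>
      sub_nonneg.2 (hfK ω)).ae_upperRate_le_of_ergodic hT
      (fun n => Finset.measurable_fun_sum _ fun k _ =>
        (hf.const_sub K).comp (hT'.iterate k).measurable)
      (integrable_birkhoffSum hT' h_gap) fun n => ?_
    rw [integral_birkhoffSum hT' h_gap, integral_sub (integrable_const K) hfi, integral_const,
      probReal_univ, one_smul]
  filter_upwards [h_rate] with ω hω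
  filter_upwards [eventually_lt_mul_of_upperRate_lt
    (hω.trans_lt (EReal.coe_lt_coe_iff.2 (sub_lt_sub_left hη K)))] with n hn
  simp only [birkhoffSum, Finset.sum_sub_distrib, Finset.sum_const, Finset.card_range,
    nsmul_eq_mul] at hn ⊢
  linarith

end Ergodic

section ProductMeasure

variable {ι : Type*} {E : ι → Type*} [∀ i, MeasurableSpace (E i)]

theorem exists_measurable_comp_restrict_eq [∀ i, Nonempty (E i)] {β : Type*} [MeasurableSpace β]
    {f : (∀ i, E i) → β} (hf : Measurable f) {s : Finset ι} (hs : DependsOn f s) :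
    ∃ g : (∀ i : s, E i) → β, Measurable g ∧ g ∘ s.restrict = f := by
  classical
  refine ⟨fun y => f (Function.updateFinset (fun _ => Classical.arbitrary _) s y),
    hf.comp measurable_updateFinset, funext fun x => hs fun i hi => ?_⟩
  rw [Finset.mem_coe] at hi
  simp only [Function.updateFinset, hi, dif_pos, Finset.restrict]

variable (ν : ∀ i, Measure (E i)) [∀ i, IsProbabilityMeasure (ν i)]

theorem indepFun_infinitePi_of_dependsOn {β γ : Type*} [MeasurableSpace β] [MeasurableSpace γ]
    {f : (∀ i, E i) → β} {g : (∀ i, E i) → γ} (hf : Measurable f) (hg : Measurable g)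
    {s t : Finset ι} (hst : Disjoint s t) (hfs : DependsOn f s) (hgt : DependsOn g t) :
    IndepFun f g (Measure.infinitePi ν) := by
  have h_nonempty (i : ι) : Nonempty (E i) := (ν i).nonempty_of_neZero
  obtain ⟨f', hf', rfl⟩ := exists_measurable_comp_restrict_eq hf hfs
  obtain ⟨g', hg', rfl⟩ := exists_measurable_comp_restrict_eq hg hgt
  exact ((iIndepFun_infinitePi (P := ν) (X := fun _ x => x) fun _ => measurable_id).indepFun_finset
    s t hst fun i => measurable_pi_apply i).comp hf' hg'

theorem iIndepFun_infinitePi_of_dependsOn {κ : Type*} {β : κ → Type*}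
    [∀ k, MeasurableSpace (β k)] {f : ∀ k, (∀ i, E i) → β k} (hf : ∀ k, Measurable (f k))
    {s : κ → Finset ι} (hs : Pairwise (Function.onFun Disjoint s))
    (hfs : ∀ k, DependsOn (f k) (s k)) : iIndepFun f (Measure.infinitePi ν) := by
  classical
  rw [iIndepFun_iff_measure_inter_preimage_eq_mul]
  intro t A hA
  induction t using Finset.induction_on with
  | empty => simp
  | insert k t hk ih =>
    let g : (∀ i, E i) → ∀ j : t, β j := fun x j => f j x
    have h_preimage : ⋂ j ∈ t, f j ⁻¹' A j = g ⁻¹' Set.univ.pi fun j => A j := by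
      ext x
      simp [g]
    have h_dependsOn : DependsOn g (t.biUnion s) := fun x y hxy => funext fun j =>
      hfs j fun i hi => hxy i (Finset.mem_coe.2 (Finset.mem_biUnion.2 ⟨j, j.2, hi⟩))
    have h_disjoint : Disjoint (s k) (t.biUnion s) :=
      (Finset.disjoint_biUnion_right _ _ _).2 fun j hj => hs (ne_of_mem_of_not_mem hj hk).symm
    rw [Finset.prod_insert hk, ← ih fun j hj => hA j (Finset.mem_insert_of_mem hj),
      Finset.set_biInter_insert, h_preimage]
    exact (indepFun_infinitePi_of_dependsOn ν (hf k) (measurable_pi_lambda g fun j => hf j)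
      h_disjoint (hfs k) h_dependsOn).measure_inter_preimage_eq_mul _ _
      (hA k (Finset.mem_insert_self k t))
      (.univ_pi fun j => hA j (Finset.mem_insert_of_mem j.2))

theorem lintegral_mul_eval_infinitePi {f : (∀ i, E i) → ENNReal} (hf : Measurable f)
    {s : Finset ι} (hfs : DependsOn f s) {i : ι} (hi : i ∉ s) {g : E i → ENNReal}
    (hg : Measurable g) :
    ∫⁻ x, f x * g (x i) ∂Measure.infinitePi ν
      = (∫⁻ x, f x ∂Measure.infinitePi ν) * ∫⁻ y, g y ∂ν i := by
  have h_eval : Measurable fun x : ∀ i, E i => g (x i) := hg.comp (measurable_pi_apply i)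
  rw [← (measurePreserving_eval_infinitePi ν i).lintegral_comp hg]
  refine lintegral_mul_eq_lintegral_mul_lintegral_of_indepFun hf h_eval
    (indepFun_infinitePi_of_dependsOn ν hf h_eval (t := {i}) (Finset.disjoint_singleton_right.2 hi)
      hfs fun x y hxy => ?_)
  rw [hxy i (by simp)]

end ProductMeasure

section LaplaceTransform

variable {Ω : Type*} [MeasurableSpace Ω] {P : Measure Ω}

theorem abs_one_sub_exp_neg_le_one {x : ℝ} (hx : 0 ≤ x) : |1 - Real.exp (-x)| ≤ 1 := by
  have h_pos := Real.exp_pos (-x)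
  have h_le : Real.exp (-x) ≤ 1 := Real.exp_le_one_iff.2 (neg_nonpos.2 hx)
  rw [abs_le]
  constructor <;> linarith

theorem integrable_one_sub_exp_neg_mul [IsFiniteMeasure P] {Y : Ω → ℝ} (hY : Measurable Y)
    (hY0 : ∀ ω, 0 ≤ Y ω) {θ : ℝ} (hθ : 0 ≤ θ) : Integrable (fun ω => 1 - Real.exp (-(θ * Y ω))) P :=
  .of_bound (by fun_prop) 1 (.of_forall fun ω => abs_one_sub_exp_neg_le_one (mul_nonneg hθ (hY0 ω)))

theorem tendsto_inv_mul_integral_one_sub_exp_neg_mul {Y : Ω → ℝ} (hY0 : ∀ ω, 0 ≤ Y ω)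
    (hY : Integrable Y P) :
    Tendsto (fun θ => θ⁻¹ * ∫ ω, (1 - Real.exp (-(θ * Y ω))) ∂P) (𝓝[>] 0) (𝓝 (∫ ω, Y ω ∂P)) := by
  simp only [← integral_const_mul]
  refine tendsto_integral_filter_of_dominated_convergence Y ?_ ?_ hY (.of_forall fun ω => ?_)
  · have := hY.aemeasurable
    exact .of_forall fun θ => by fun_prop
  · filter_upwards [self_mem_nhdsWithin] with θ (hθ : 0 < θ)
    refine .of_forall fun ω => ?_
    have h_nonneg : 0 ≤ 1 - Real.exp (-(θ * Y ω)) :=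
      sub_nonneg.2 (Real.exp_le_one_iff.2 (neg_nonpos.2 (mul_nonneg hθ.le (hY0 ω))))
    rw [Real.norm_of_nonneg (by positivity), inv_mul_le_iff₀ hθ]
    linarith [Real.one_sub_le_exp_neg (θ * Y ω)]
  · have h_deriv : HasDerivAt (fun θ => 1 - Real.exp (-(θ * Y ω))) (Y ω) 0 := by
      simpa using (((hasDerivAt_id (0 : ℝ)).mul_const (Y ω)).neg.exp).const_sub 1
    simpa using h_deriv.tendsto_slope_zero_right

variable [IsProbabilityMeasure P]

theorem mgf_neg_le_exp {Y : Ω → ℝ} (hY : Measurable Y) (hY0 : ∀ ω, 0 ≤ Y ω) {θ : ℝ}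
    (hθ : 0 ≤ θ) : mgf Y P (-θ) ≤ Real.exp (-∫ ω, (1 - Real.exp (-(θ * Y ω))) ∂P) := by
  have h_mgf : mgf Y P (-θ) = 1 - ∫ ω, (1 - Real.exp (-(θ * Y ω))) ∂P := by
    have h_sub := integral_sub (integrable_const (1 : ℝ))
      (integrable_one_sub_exp_neg_mul (P := P) hY hY0 hθ)
    simpa only [mgf, sub_sub_cancel, integral_const, probReal_univ, one_smul, ← neg_mul]
      using h_sub
  rw [h_mgf, sub_eq_neg_add]
  exact Real.add_one_le_exp _

theorem measureReal_sum_le_le_exp {κ : Type*} {Y : κ → Ω → ℝ} (hY : ∀ i, Measurable (Y i))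
    (hY0 : ∀ i ω, 0 ≤ Y i ω) (h_indep : iIndepFun Y P) (s : Finset κ) {θ : ℝ} (hθ : 0 ≤ θ)
    (x : ℝ) : P.real {ω | ∑ i ∈ s, Y i ω ≤ x}
      ≤ Real.exp (θ * x - ∑ i ∈ s, ∫ ω, (1 - Real.exp (-(θ * Y i ω))) ∂P) := by
  have h_integrable : Integrable (fun ω => Real.exp (-θ * (∑ i ∈ s, Y i) ω)) P := by
    refine .of_bound (by simp only [Finset.sum_apply]; fun_prop) 1 (.of_forall fun ω => ?_)
    rw [Real.norm_of_nonneg (Real.exp_pos _).le, Real.exp_le_one_iff, Finset.sum_apply, neg_mul]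
    exact neg_nonpos.2 (mul_nonneg hθ (Finset.sum_nonneg fun i _ => hY0 i ω))
  calc P.real {ω | ∑ i ∈ s, Y i ω ≤ x}
      = P.real {ω | (∑ i ∈ s, Y i) ω ≤ x} := by simp only [Finset.sum_apply]
    _ ≤ Real.exp (-(-θ) * x) * mgf (∑ i ∈ s, Y i) P (-θ) :=
        measure_le_le_exp_mul_mgf x (neg_nonpos.2 hθ) h_integrable
    _ = Real.exp (θ * x) * ∏ i ∈ s, mgf (Y i) P (-θ) := by rw [neg_neg, h_indep.mgf_sum hY]
    _ ≤ Real.exp (θ * x) * ∏ i ∈ s, Real.exp (-∫ ω, (1 - Real.exp (-(θ * Y i ω))) ∂P) := by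
        gcongr with i
        · exact fun i _ => mgf_nonneg
        · exact mgf_neg_le_exp (hY i) (hY0 i) hθ
    _ = _ := by rw [← Real.exp_sum, ← Real.exp_add, Finset.sum_neg_distrib, sub_eq_add_neg]

end LaplaceTransform

section Limits

theorem ae_eventually_notMem_of_le_exp {Ω : Type*} [MeasurableSpace Ω] {P : Measure Ω}
    [IsFiniteMeasure P] {A : ℕ → Set Ω}
    (h : ∀ᶠ n : ℕ in atTop, P (A n) ≤ ENNReal.ofReal (Real.exp (-n))) :
    ∀ᵐ ω ∂P, ∀ᶠ n in atTop, ω ∉ A n := by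
  have h_summable : Summable fun n => P.real (A n) := by
    refine Real.summable_exp_neg_nat.of_norm_bounded_eventually_nat (h.mono fun n hn => ?_)
    rw [Real.norm_of_nonneg measureReal_nonneg]
    exact ENNReal.toReal_le_of_le_ofReal (Real.exp_pos _).le hn
  refine ae_eventually_notMem ?_
  simpa only [ofReal_measureReal (measure_ne_top P _)] using h_summable.tsum_ofReal_ne_top

theorem ae_tendsto_of_forall_ae_eventually {Ω : Type*} [MeasurableSpace Ω] {P : Measure Ω}
    {f : ℕ → Ω → ℝ} {a : ℝ} (h_lower : ∀ r < a, ∀ᵐ ω ∂P, ∀ᶠ n in atTop, r < f n ω)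
    (h_upper : ∀ r, a < r → ∀ᵐ ω ∂P, ∀ᶠ n in atTop, f n ω < r) :
    ∀ᵐ ω ∂P, Tendsto (fun n => f n ω) atTop (𝓝 a) := by
  have h_lower_rat : ∀ᵐ ω ∂P, ∀ r : ℚ, r < a → ∀ᶠ n in atTop, r < f n ω := by
    simpa only [ae_all_iff] using fun (r : ℚ) => h_lower r
  have h_upper_rat : ∀ᵐ ω ∂P, ∀ r : ℚ, a < r → ∀ᶠ n in atTop, f n ω < r := by
    simpa only [ae_all_iff] using fun (r : ℚ) => h_upper r
  filter_upwards [h_lower_rat, h_upper_rat] with ω h_lower h_upper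
  refine tendsto_order.2 ⟨fun b hb => ?_, fun b hb => ?_⟩
  · obtain ⟨r, hbr, hra⟩ := exists_rat_btwn hb
    exact (h_lower r hra).mono fun n hn => hbr.trans hn
  · obtain ⟨r, har, hrb⟩ := exists_rat_btwn hb
    exact (h_upper r har).mono fun n hn => hn.trans hrb

theorem tendsto_natCast_natDiv_div (q : ℕ) :
    Tendsto (fun n : ℕ => ((n / q : ℕ) : ℝ) / n) atTop (𝓝 (q : ℝ)⁻¹) := by
  have h_floor := (tendsto_nat_floor_mul_div_atTop (inv_nonneg.2 (q.cast_nonneg (α := ℝ)))).comp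
    (tendsto_natCast_atTop_atTop (R := ℝ))
  refine h_floor.congr fun n => ?_
  rw [Function.comp_apply, inv_mul_eq_div, Nat.floor_div_eq_div]

theorem natDiv_mul_floor_le (n q : ℕ) (s : ℝ) : n / q * ⌊q * s⌋₊ ≤ ⌊n * s⌋₊ := by
  rcases le_total s 0 with hs | hs
  · simp [Nat.floor_of_nonpos (mul_nonpos_of_nonneg_of_nonpos q.cast_nonneg hs)]
  · refine Nat.le_floor ?_
    calc ((n / q * ⌊q * s⌋₊ : ℕ) : ℝ) ≤ (n / q : ℕ) * (q * s) := by
          rw [Nat.cast_mul]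
          gcongr
          exact Nat.floor_le (by positivity)
      _ = (n / q * q : ℕ) * s := by push_cast; ring
      _ ≤ n * s := by gcongr; exact Nat.div_mul_le_self n q

theorem floor_le_natDiv_add_one_mul_ceil {q : ℕ} (hq : 0 < q) (n : ℕ) (s : ℝ) :
    ⌊n * s⌋₊ ≤ (n / q + 1) * ⌈q * s⌉₊ := by
  rcases le_total s 0 with hs | hs
  · simp [Nat.floor_of_nonpos (mul_nonpos_of_nonneg_of_nonpos n.cast_nonneg hs)]
  · refine Nat.floor_le_of_le ?_
    calc n * s ≤ ((n / q + 1) * q : ℕ) * s := by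
          gcongr
          exact (Nat.lt_mul_of_div_lt (Nat.lt_succ_self _) hq).le
      _ = (n / q + 1 : ℕ) * (q * s) := by push_cast; ring
      _ ≤ ((n / q + 1) * ⌈q * s⌉₊ : ℕ) := by
          rw [Nat.cast_mul]
          gcongr
          exact Nat.le_ceil _

theorem tendsto_neg_inv_mul_log_top {u : ℕ → ENNReal}
    (h : ∀ C : ℝ, ∀ᶠ n : ℕ in atTop, u n ≤ ENNReal.ofReal (Real.exp (-(C * n)))) :
    Tendsto (fun n : ℕ => -(((1 / (n : ℝ) : ℝ) : EReal) * ENNReal.log (u n))) atTop (𝓝 ⊤) := by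
  refine EReal.tendsto_nhds_top_iff_real.2 fun x => ?_
  filter_upwards [h (x + 1), eventually_gt_atTop 0] with n hn hn0
  have h_log : ENNReal.log (u n) ≤ (-((x + 1) * n) : ℝ) := by
    simpa only [ENNReal.log_ofReal_of_pos (Real.exp_pos _), Real.log_exp] using
      ENNReal.log_le_log hn
  have h_mul : ((1 / (n : ℝ) : ℝ) : EReal) * ENNReal.log (u n) ≤ (-(x + 1) : ℝ) := by
    refine (mul_le_mul_of_nonneg_left h_log (by exact_mod_cast (by positivity))).trans_eq ?_
    rw [← EReal.coe_mul]
    congr 1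
    field_simp
  calc (x : EReal) < (x + 1 : ℝ) := by exact_mod_cast lt_add_one x
    _ = -((-(x + 1) : ℝ) : EReal) := by rw [← EReal.coe_neg, neg_neg]
    _ ≤ _ := EReal.neg_le_neg_iff.2 h_mul

end Limits

section ExponentialMoments

theorem integrable_of_lintegral_exp_mul_ne_top {Ω : Type*} [MeasurableSpace Ω] {P : Measure Ω}
    {X : Ω → ℝ} (hX : Measurable X) (hX0 : ∀ ω, 0 ≤ X ω) {t : ℝ} (ht : 0 < t)
    (h : ∫⁻ ω, ENNReal.ofReal (Real.exp (t * X ω)) ∂P ≠ ⊤) : Integrable X P := by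
  have h_exp : Integrable (fun ω => Real.exp (t * X ω)) P :=
    ⟨by fun_prop, (hasFiniteIntegral_iff_ofReal (.of_forall fun ω => (Real.exp_pos _).le)).2
      h.lt_top⟩
  refine (h_exp.const_mul t⁻¹).mono' hX.aestronglyMeasurable (.of_forall fun ω => ?_)
  rw [Real.norm_of_nonneg (hX0 ω), le_inv_mul_iff₀ ht]
  linarith [Real.add_one_le_exp (t * X ω)]

theorem ofReal_exp_integral_le_lintegral {Ω : Type*} [MeasurableSpace Ω] {P : Measure Ω}
    [IsProbabilityMeasure P] {X : Ω → ℝ} (hX : Integrable X P) :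
    ENNReal.ofReal (Real.exp (∫ ω, X ω ∂P)) ≤ ∫⁻ ω, ENNReal.ofReal (Real.exp (X ω)) ∂P := by
  have h_nonneg : 0 ≤ᵐ[P] fun ω => Real.exp (X ω) := .of_forall fun ω => (Real.exp_pos _).le
  rcases eq_or_ne (∫⁻ ω, ENNReal.ofReal (Real.exp (X ω)) ∂P) ⊤ with h_top | h_top
  · exact h_top ▸ le_top
  · have h_exp : Integrable (fun ω => Real.exp (X ω)) P :=
      ⟨Real.continuous_exp.comp_aestronglyMeasurable hX.aestronglyMeasurable,
        (hasFiniteIntegral_iff_ofReal h_nonneg).2 h_top.lt_top⟩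
    rw [← ofReal_integral_eq_lintegral_ofReal h_exp h_nonneg]
    exact ENNReal.ofReal_le_ofReal (convexOn_exp.map_integral_le Real.continuous_exp.continuousOn
      isClosed_univ (.of_forall fun _ => Set.mem_univ _) hX h_exp)

theorem ofReal_exp_mul_max_add_le (t u v x : ℝ) : ENNReal.ofReal (Real.exp (t * (max u v + x)))
    ≤ ENNReal.ofReal (Real.exp (t * u)) * ENNReal.ofReal (Real.exp (t * x))
      + ENNReal.ofReal (Real.exp (t * v)) * ENNReal.ofReal (Real.exp (t * x)) := by
  rw [mul_add, Real.exp_add, ENNReal.ofReal_mul (by positivity), ← add_mul]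
  gcongr
  rcases max_cases u v with ⟨h, -⟩ | ⟨h, -⟩ <;> rw [h]
  exacts [le_self_add, le_add_self]

theorem lintegral_exp_mul_expMeasure {r t : ℝ} (hr : 0 < r) (ht : t < r) :
    ∫⁻ x, ENNReal.ofReal (Real.exp (t * x)) ∂expMeasure r = ENNReal.ofReal (r / (r - t)) := by
  have hrt : 0 < r - t := sub_pos.2 ht
  have h_density (x : ℝ) : (gammaPDF 1 r * fun x => ENNReal.ofReal (Real.exp (t * x))) x
      = ENNReal.ofReal (r / (r - t)) * exponentialPDF (r - t) x := by
    change exponentialPDF r x * ENNReal.ofReal (Real.exp (t * x)) = _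
    rcases lt_or_ge x 0 with hx | hx
    · simp only [exponentialPDF_of_neg hx, zero_mul, mul_zero]
    · rw [exponentialPDF_of_nonneg hx, exponentialPDF_of_nonneg hx,
        ← ENNReal.ofReal_mul (by positivity), ← ENNReal.ofReal_mul (by positivity), mul_assoc,
        ← Real.exp_add, ← mul_assoc, div_mul_cancel₀ _ hrt.ne']
      ring_nf
  have h_meas : Measurable (gammaPDF 1 r) := (measurable_gammaPDFReal 1 r).ennreal_ofReal
  rw [expMeasure, gammaMeasure, lintegral_withDensity_eq_lintegral_mul _ h_meas (by fun_prop)]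
  simp only [h_density]
  rw [lintegral_const_mul' _ _ ENNReal.ofReal_ne_top, lintegral_exponentialPDF_eq_one hrt, mul_one]

end ExponentialMoments

noncomputable section

namespace CornerGrowth

section LastPassage

/-- The array `w` seen from the point `(x, y)`. -/
def translate (x y : ℕ) (w : ℕ × ℕ → ℝ) : ℕ × ℕ → ℝ := fun ij => w (ij.1 + x, ij.2 + y)

@[fun_prop]
theorem measurable_translate (x y : ℕ) : Measurable (translate x y) := by
  unfold translate
  fun_prop

theorem iterate_translate (k l n : ℕ) : (translate k l)^[n] = translate (n * k) (n * l) := by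
  induction n with
  | zero => ext; simp [translate]
  | succ n ih =>
    rw [Function.iterate_succ', ih]
    ext
    simp [translate, add_mul, add_assoc, add_comm, add_left_comm]

@[simp]
theorem lastPassage_zero_left (w : ℕ × ℕ → ℝ) (n : ℕ) : lastPassage w 0 n = 0 := by
  rw [lastPassage]

@[simp]
theorem lastPassage_zero_right (w : ℕ × ℕ → ℝ) (m : ℕ) : lastPassage w m 0 = 0 := by
  cases m <;> rw [lastPassage]

theorem lastPassage_succ_succ (w : ℕ × ℕ → ℝ) (m n : ℕ) : lastPassage w (m + 1) (n + 1)
    = max (lastPassage w m (n + 1)) (lastPassage w (m + 1) n) + w (m, n) := by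
  rw [lastPassage]

@[fun_prop]
theorem measurable_lastPassage (m n : ℕ) : Measurable fun w => lastPassage w m n := by
  induction m generalizing n with
  | zero => simp
  | succ m ihm =>
    induction n with
    | zero => simp
    | succ n ihn =>
      simp only [lastPassage_succ_succ]
      exact ((ihm _).max ihn).add (measurable_pi_apply _)

theorem dependsOn_lastPassage (m n : ℕ) :
    DependsOn (fun w => lastPassage w m n) (Finset.range m ×ˢ Finset.range n : Finset (ℕ × ℕ)) := by
  simp only [DependsOn, Finset.mem_coe, Finset.mem_product, Finset.mem_range, Prod.forall]
  intro w w' h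
  induction m generalizing n with
  | zero => simp
  | succ m ihm =>
    induction n with
    | zero => simp
    | succ n ihn =>
      rw [lastPassage_succ_succ, lastPassage_succ_succ, ihm (n + 1) fun i j _ => h i j (by omega),
        ihn fun i j _ => h i j (by omega), h m n (by omega)]

variable {w : ℕ × ℕ → ℝ} (hw : ∀ ij, 0 ≤ w ij)
include hw

theorem lastPassage_mono {m m' n n' : ℕ} (hm : m ≤ m') (hn : n ≤ n') :
    lastPassage w m n ≤ lastPassage w m' n' := by
  have h_left (n : ℕ) : Monotone fun m => lastPassage w m n := by
    refine monotone_nat_of_le_succ fun m => ?_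
    cases n with
    | zero => simp
    | succ n =>
      rw [lastPassage_succ_succ]
      exact (le_max_left _ _).trans (le_add_of_nonneg_right (hw _))
  have h_right (m : ℕ) : Monotone fun n => lastPassage w m n := by
    refine monotone_nat_of_le_succ fun n => ?_
    cases m with
    | zero => simp
    | succ m =>
      rw [lastPassage_succ_succ]
      exact (le_max_right _ _).trans (le_add_of_nonneg_right (hw _))
  exact (h_left n hm).trans (h_right m' hn)

theorem lastPassage_nonneg (m n : ℕ) : 0 ≤ lastPassage w m n := by
  simpa using lastPassage_mono hw m.zero_le le_rfl

theorem lastPassage_add_le (x y m n : ℕ) :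
    lastPassage w x y + lastPassage (translate x y w) m n ≤ lastPassage w (x + m) (y + n) := by
  induction m generalizing n with
  | zero => simpa using lastPassage_mono hw le_rfl (Nat.le_add_right y n)
  | succ m ihm =>
    induction n with
    | zero => simpa using lastPassage_mono hw (Nat.le_add_right x (m + 1)) le_rfl
    | succ n ihn =>
      rw [← add_assoc, ← add_assoc, lastPassage_succ_succ, lastPassage_succ_succ, ← add_assoc,
        ← max_add_add_left, translate, add_comm m x, add_comm n y]
      exact add_le_add_left (max_le_max (ihm (n + 1)) ihn) _

theorem sum_lastPassage_le (y k l N : ℕ) :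
    ∑ i ∈ Finset.range N, lastPassage (translate (i * k) ((i + y) * l) w) k l
      ≤ lastPassage w (N * k) ((N + y) * l) := by
  induction N with
  | zero => simpa only [Finset.sum_range_zero] using lastPassage_nonneg hw _ _
  | succ N ih =>
    rw [Finset.sum_range_succ, add_one_mul, add_right_comm, add_one_mul]
    exact (add_le_add_left ih _).trans (lastPassage_add_le hw _ _ k l)

omit hw

theorem lintegral_exp_mul_lastPassage_le (ν : ℕ × ℕ → Measure ℝ)
    [∀ ij, IsProbabilityMeasure (ν ij)] {t : ℝ} {B : ENNReal} (hB : 1 ≤ B)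
    (hν : ∀ ij, ∫⁻ x, ENNReal.ofReal (Real.exp (t * x)) ∂ν ij ≤ B) (m n : ℕ) :
    ∫⁻ w, ENNReal.ofReal (Real.exp (t * lastPassage w m n)) ∂Measure.infinitePi ν
      ≤ (2 * B) ^ (m + n) := by
  have h_one : 1 ≤ 2 * B := hB.trans (le_mul_of_one_le_left' one_le_two)
  have h_step (a b m n : ℕ) (h : a ≤ m ∨ b ≤ n) :
      ∫⁻ w, ENNReal.ofReal (Real.exp (t * lastPassage w a b))
        * ENNReal.ofReal (Real.exp (t * w (m, n))) ∂Measure.infinitePi ν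
        ≤ (∫⁻ w, ENNReal.ofReal (Real.exp (t * lastPassage w a b)) ∂Measure.infinitePi ν) * B := by
    rw [lintegral_mul_eval_infinitePi ν (i := (m, n)) (by fun_prop)
      (fun w w' hww => congrArg (fun G => ENNReal.ofReal (Real.exp (t * G)))
        (dependsOn_lastPassage a b hww))
      (by simp only [Finset.mem_product, Finset.mem_range]; omega)
      (g := fun x => ENNReal.ofReal (Real.exp (t * x))) (by fun_prop)]
    gcongr
    exact hν (m, n)
  induction m generalizing n with
  | zero => simpa using one_le_pow₀ h_one
  | succ m ihm =>
    induction n with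
    | zero => simpa using one_le_pow₀ h_one
    | succ n ihn =>
      simp only [lastPassage_succ_succ]
      refine (lintegral_mono fun w => ofReal_exp_mul_max_add_le t _ _ _).trans ?_
      rw [lintegral_add_left (by fun_prop)]
      calc _ ≤ (2 * B) ^ (m + (n + 1)) * B + (2 * B) ^ (m + 1 + n) * B :=
            add_le_add ((h_step _ _ m n (.inl le_rfl)).trans (by gcongr; exact ihm (n + 1)))
              ((h_step _ _ m n (.inr le_rfl)).trans (by gcongr))
        _ = (2 * B) ^ (m + 1 + (n + 1)) := by ring

end LastPassage

section Coupling

instance instIsProbabilityMeasureExpOne : IsProbabilityMeasure (expMeasure 1) :=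
  isProbabilityMeasure_expMeasure one_pos

/-- The law of an array of independent exponential variables with rate `1`. It drives the weights
for all parameters simultaneously. -/
def expArray : Measure (ℕ × ℕ → ℝ) := Measure.infinitePi fun _ => expMeasure 1

instance instIsProbabilityMeasureExpArray : IsProbabilityMeasure expArray := by
  unfold expArray
  infer_instance

/-- The weights with parameters `p` obtained by rescaling the array `e`. The absolute value makes
them nonnegative everywhere and changes nothing for `expArray`-almost every `e`. -/
def weight (p : PosSeq × PosSeq) (e : ℕ × ℕ → ℝ) : ℕ × ℕ → ℝ :=
  fun ij => |e ij| / ((p.1 ij.1 : ℝ) + (p.2 ij.2 : ℝ))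

theorem rate_pos (p : PosSeq × PosSeq) (i j : ℕ) : 0 < (p.1 i : ℝ) + (p.2 j : ℝ) :=
  add_pos (p.1 i).2 (p.2 j).2

theorem weight_nonneg (p : PosSeq × PosSeq) (e : ℕ × ℕ → ℝ) (ij : ℕ × ℕ) : 0 ≤ weight p e ij :=
  div_nonneg (abs_nonneg _) (rate_pos _ _ _).le

@[fun_prop]
theorem measurable_weight :
    Measurable fun x : (PosSeq × PosSeq) × (ℕ × ℕ → ℝ) => weight x.1 x.2 := by
  unfold weight
  fun_prop

@[fun_prop]
theorem measurable_weight_right (p : PosSeq × PosSeq) : Measurable (weight p) :=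
  measurable_weight.comp measurable_prodMk_left

theorem ae_nonneg_expMeasure (r : ℝ) : ∀ᵐ x ∂expMeasure r, 0 ≤ x := by
  have h_neg : {x : ℝ | ¬0 ≤ x} = Set.Iio 0 := by
    ext
    simp
  rw [ae_iff, h_neg, expMeasure, gammaMeasure, withDensity_apply _ measurableSet_Iio]
  exact lintegral_gammaPDF_of_nonpos le_rfl

theorem map_div_expMeasure_one {r : ℝ} (hr : 0 < r) :
    (expMeasure 1).map (fun x => x / r) = expMeasure r := by
  have h_meas : Measurable fun x : ℝ => x / r := by fun_prop
  have h_preimage (x : ℝ) : (fun x : ℝ => x / r) ⁻¹' Set.Iic x = Set.Iic (r * x) := by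
    ext
    simp [div_le_iff₀ hr, mul_comm]
  have := isProbabilityMeasure_expMeasure hr
  have := Measure.isProbabilityMeasure_map (μ := expMeasure 1) h_meas.aemeasurable
  refine Measure.eq_of_cdf _ _ (StieltjesFunction.ext fun x => ?_)
  rw [cdf_expMeasure_eq hr, cdf_eq_real, map_measureReal_apply h_meas measurableSet_Iic,
    h_preimage, ← cdf_eq_real, cdf_expMeasure_eq one_pos]
  simp [mul_nonneg_iff_of_pos_left hr]

theorem map_weight (p : PosSeq × PosSeq) : expArray.map (weight p) = quenched p := by
  have h_coord (ij : ℕ × ℕ) : (expMeasure 1).map (fun x => |x| / ((p.1 ij.1 : ℝ) + p.2 ij.2))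
      = expMeasure ((p.1 ij.1 : ℝ) + p.2 ij.2) := by
    rw [← map_div_expMeasure_one (rate_pos p _ _)]
    refine Measure.map_congr ?_
    filter_upwards [ae_nonneg_expMeasure 1] with x hx
    rw [abs_of_nonneg hx]
  unfold expArray quenched weight
  simp only [← h_coord]
  exact Measure.infinitePi_map_pi (fun _ : ℕ × ℕ => expMeasure 1)
    (f := fun ij x => |x| / ((p.1 ij.1 : ℝ) + p.2 ij.2)) (by fun_prop)

/-- The parameters seen from the point `(k, l)`. -/
def shiftPair (k l : ℕ) : PosSeq × PosSeq → PosSeq × PosSeq := Prod.map (shift k) (shift l)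

@[fun_prop]
theorem measurable_shift (k : ℕ) : Measurable (shift k) := by
  unfold shift
  fun_prop

@[fun_prop]
theorem measurable_shiftPair (k l : ℕ) : Measurable (shiftPair k l) := by
  unfold shiftPair
  fun_prop

theorem shiftPair_shiftPair (k l k' l' : ℕ) (p : PosSeq × PosSeq) :
    shiftPair k l (shiftPair k' l' p) = shiftPair (k + k') (l + l') p := by
  ext <;> simp [shiftPair, shift, add_assoc]

theorem iterate_shiftPair (k l n : ℕ) : (shiftPair k l)^[n] = shiftPair (n * k) (n * l) := by
  induction n with
  | zero => ext <;> simp [shiftPair, shift]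
  | succ n ih =>
    funext p
    rw [Function.iterate_succ_apply', ih, shiftPair_shiftPair, add_one_mul, add_one_mul, add_comm k,
      add_comm l]

theorem measurePreserving_translate (x y : ℕ) :
    MeasurePreserving (translate x y) expArray expArray := by
  refine ⟨measurable_translate x y, ?_⟩
  unfold expArray translate
  exact Measure.map_infinitePi_infinitePi_of_inj (P := fun _ : ℕ × ℕ => expMeasure 1)
    (f := fun ij : ℕ × ℕ => (ij.1 + x, ij.2 + y)) fun a b h => by simpa [Prod.ext_iff] using h

/-- The last-passage time to `(m, n)` of the weights with parameters `p` built from `e`. -/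
def passage (p : PosSeq × PosSeq) (e : ℕ × ℕ → ℝ) (m n : ℕ) : ℝ := lastPassage (weight p e) m n

theorem passage_nonneg (p : PosSeq × PosSeq) (e : ℕ × ℕ → ℝ) (m n : ℕ) : 0 ≤ passage p e m n :=
  lastPassage_nonneg (weight_nonneg p e) m n

theorem passage_mono (p : PosSeq × PosSeq) (e : ℕ × ℕ → ℝ) {m m' n n' : ℕ} (hm : m ≤ m')
    (hn : n ≤ n') : passage p e m n ≤ passage p e m' n' :=
  lastPassage_mono (weight_nonneg p e) hm hn

@[fun_prop]
theorem measurable_passage (m n : ℕ) :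
    Measurable fun x : (PosSeq × PosSeq) × (ℕ × ℕ → ℝ) => passage x.1 x.2 m n :=
  (measurable_lastPassage m n).comp measurable_weight

@[fun_prop]
theorem measurable_passage_right (p : PosSeq × PosSeq) (m n : ℕ) :
    Measurable fun e : ℕ × ℕ → ℝ => passage p e m n :=
  (measurable_passage m n).comp measurable_prodMk_left

theorem quenched_lastPassage_le (p : PosSeq × PosSeq) (m n : ℕ) (x : ℝ) :
    quenched p {w | lastPassage w m n ≤ x} = expArray {e | passage p e m n ≤ x} := by
  rw [← map_weight, Measure.map_apply (measurable_weight_right p)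
    (measurableSet_le (measurable_lastPassage m n) measurable_const)]
  rfl

end Coupling

section Blocks

/-- The last-passage time across the `b`-th block of size `k × l`, the one between the points
`(b.1 * k, b.2 * l)` and `((b.1 + 1) * k, (b.2 + 1) * l)`. -/
def blockPassage (p : PosSeq × PosSeq) (k l : ℕ) (b : ℕ × ℕ) (e : ℕ × ℕ → ℝ) : ℝ :=
  passage (shiftPair (b.1 * k) (b.2 * l) p) (translate (b.1 * k) (b.2 * l) e) k l

@[fun_prop]
theorem measurable_blockPassage (p : PosSeq × PosSeq) (k l : ℕ) (b : ℕ × ℕ) :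
    Measurable (blockPassage p k l b) := by
  unfold blockPassage
  fun_prop

theorem iIndepFun_blockPassage (p : PosSeq × PosSeq) (k l : ℕ) :
    iIndepFun (blockPassage p k l) expArray := by
  refine iIndepFun_infinitePi_of_dependsOn (fun _ => expMeasure 1)
    (measurable_blockPassage p k l)
    (s := fun b => Finset.Ico (b.1 * k) ((b.1 + 1) * k) ×ˢ Finset.Ico (b.2 * l) ((b.2 + 1) * l))
    (fun b b' hb => Finset.disjoint_left.2 fun x hx hx' => hb ?_) (fun b e e' h => ?_)
  · simp only [Finset.mem_product, Finset.mem_Ico] at hx hx'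
    exact Prod.ext
      ((Nat.div_eq_of_lt_le hx.1.1 hx.1.2).symm.trans (Nat.div_eq_of_lt_le hx'.1.1 hx'.1.2))
      ((Nat.div_eq_of_lt_le hx.2.1 hx.2.2).symm.trans (Nat.div_eq_of_lt_le hx'.2.1 hx'.2.2))
  · refine dependsOn_lastPassage k l fun ij hij => ?_
    simp only [Finset.mem_coe, Finset.mem_product, Finset.mem_range] at hij
    have h_entry : e (ij.1 + b.1 * k, ij.2 + b.2 * l) = e' (ij.1 + b.1 * k, ij.2 + b.2 * l) := by
      refine h _ ?_
      simp only [Finset.mem_coe, Finset.mem_product, Finset.mem_Ico, add_one_mul]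
      omega
    simp only [weight, translate, h_entry]

/-- One minus the Laplace transform at `θ` of the quenched last-passage time to `(k, l)`. -/
def laplaceGap (θ : ℝ) (k l : ℕ) (p : PosSeq × PosSeq) : ℝ :=
  ∫ e, (1 - Real.exp (-(θ * passage p e k l))) ∂expArray

theorem laplaceGap_le_one {θ : ℝ} (hθ : 0 ≤ θ) (k l : ℕ) (p : PosSeq × PosSeq) :
    laplaceGap θ k l p ≤ 1 := by
  have h_le := integral_mono (μ := expArray)
    (integrable_one_sub_exp_neg_mul (measurable_passage_right p k l)
      (fun e => passage_nonneg p e k l) hθ) (integrable_const 1)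
    fun e => sub_le_self 1 (Real.exp_pos (-(θ * passage p e k l))).le
  rwa [integral_const, probReal_univ, one_smul] at h_le

theorem measurable_laplaceGap (θ : ℝ) (k l : ℕ) : Measurable (laplaceGap θ k l) := by
  have h_meas : Measurable fun x : (PosSeq × PosSeq) × (ℕ × ℕ → ℝ) =>
      1 - Real.exp (-(θ * passage x.1 x.2 k l)) := by fun_prop
  exact h_meas.stronglyMeasurable.integral_prod_right.measurable

theorem integrable_laplaceGap (μ : Measure (PosSeq × PosSeq)) [IsFiniteMeasure μ] {θ : ℝ}
    (hθ : 0 ≤ θ) (k l : ℕ) : Integrable (laplaceGap θ k l) μ :=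
  (integrable_one_sub_exp_neg_mul (P := μ.prod expArray) (measurable_passage k l)
    (fun x => passage_nonneg x.1 x.2 k l) hθ).integral_prod_left

theorem integral_laplaceGap (μ : Measure (PosSeq × PosSeq)) [IsFiniteMeasure μ] {θ : ℝ}
    (hθ : 0 ≤ θ) (k l : ℕ) : ∫ p, laplaceGap θ k l p ∂μ
      = ∫ x, (1 - Real.exp (-(θ * passage x.1 x.2 k l))) ∂μ.prod expArray :=
  (integral_prod _ (integrable_one_sub_exp_neg_mul (measurable_passage k l)
    (fun x => passage_nonneg x.1 x.2 k l) hθ)).symm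

theorem integral_one_sub_exp_neg_mul_blockPassage (p : PosSeq × PosSeq) (θ : ℝ) (k l : ℕ)
    (b : ℕ × ℕ) : ∫ e, (1 - Real.exp (-(θ * blockPassage p k l b e))) ∂expArray
      = laplaceGap θ k l (shiftPair (b.1 * k) (b.2 * l) p) := by
  have h_translate := measurePreserving_translate (b.1 * k) (b.2 * l)
  have h_map := integral_map (μ := expArray) h_translate.aemeasurable
    (f := fun e => 1 - Real.exp (-(θ * passage (shiftPair (b.1 * k) (b.2 * l) p) e k l)))
    (by fun_prop)
  rw [h_translate.map_eq] at h_map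
  exact h_map.symm

/-- The blocks on each of `L` neighbouring diagonals bound the passage time from below, and blocks
on different diagonals are independent, so the exponent gains a factor of `L`. -/
theorem measureReal_passage_le_le_exp (p : PosSeq × PosSeq) {θ : ℝ} (hθ : 0 ≤ θ) (k l N L : ℕ)
    (x : ℝ) : expArray.real {e | passage p e (N * k) ((N + L) * l) ≤ x}
      ≤ Real.exp (∑ j ∈ Finset.range L, (θ * x - ∑ i ∈ Finset.range N,
          laplaceGap θ k l (shiftPair (i * k) ((i + j) * l) p))) := by
  let block : ℕ × ℕ → ℕ × ℕ := fun c => (c.2, c.2 + c.1)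
  have h_inj : Function.Injective block := fun c c' h => by
    simp only [block, Prod.mk.injEq] at h
    ext <;> omega
  have h_subset : {e | passage p e (N * k) ((N + L) * l) ≤ x} ⊆
      {e | ∑ c ∈ Finset.range L ×ˢ Finset.range N, blockPassage p k l (block c) e ≤ L * x} := by
    intro e (he : passage p e (N * k) ((N + L) * l) ≤ x)
    have h_diagonal : ∀ j ∈ Finset.range L,
        ∑ i ∈ Finset.range N, blockPassage p k l (i, i + j) e ≤ x := fun j hj =>
      (sum_lastPassage_le (weight_nonneg p e) j k l N).trans ((passage_mono p e le_rfl
        (Nat.mul_le_mul_right l (by grind))).trans he)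
    simpa [Finset.sum_product] using Finset.sum_le_sum h_diagonal
  refine (measureReal_mono h_subset).trans ((measureReal_sum_le_le_exp
    (fun c => measurable_blockPassage p k l (block c)) (fun _ _ => passage_nonneg _ _ _ _)
    ((iIndepFun_blockPassage p k l).precomp h_inj) _ hθ _).trans_eq ?_)
  simp only [integral_one_sub_exp_neg_mul_blockPassage, Finset.sum_product, block,
    Finset.sum_sub_distrib, Finset.sum_const, Finset.card_range, nsmul_eq_mul, mul_left_comm θ]

end Blocks

section LowerTail

variable {μ : Measure (PosSeq × PosSeq)}

theorem measurePreserving_shiftPair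
    (hμ : ∀ k l : ℕ, 0 < k → 0 < l → MeasurePreserving (shiftPair k l) μ μ) (k l : ℕ) :
    MeasurePreserving (shiftPair k l) μ μ := by
  refine ⟨measurable_shiftPair k l, ?_⟩
  have h_comp : shiftPair k l ∘ shiftPair 1 1 = shiftPair (k + 1) (l + 1) :=
    funext (shiftPair_shiftPair k l 1 1)
  calc μ.map (shiftPair k l) = (μ.map (shiftPair 1 1)).map (shiftPair k l) := by
        rw [(hμ 1 1 one_pos one_pos).map_eq]
    _ = μ.map (shiftPair (k + 1) (l + 1)) := by
        rw [Measure.map_map (measurable_shiftPair k l) (measurable_shiftPair 1 1), h_comp]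
    _ = μ := (hμ _ _ k.succ_pos l.succ_pos).map_eq

/-- The mean of the last-passage time to `(m, n)`, averaged over the parameters too. -/
def meanPassage (μ : Measure (PosSeq × PosSeq)) (m n : ℕ) : ℝ :=
  ∫ x, passage x.1 x.2 m n ∂μ.prod expArray

/-- The shape function, as a supremum of normalized means. It has its intended meaning when
the means of the last-passage times grow at most linearly; the term with `q = 0` is `0`. -/
def shape (μ : Measure (PosSeq × PosSeq)) (s t : ℝ) : ℝ :=
  ⨆ q : ℕ, meanPassage μ ⌊q * s⌋₊ ⌊q * t⌋₊ / q

theorem pos_of_meanPassage_pos {k l : ℕ} (h : 0 < meanPassage μ k l) : 0 < k ∧ 0 < l := by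
  refine ⟨Nat.pos_of_ne_zero ?_, Nat.pos_of_ne_zero ?_⟩ <;> rintro rfl <;>
    simp [meanPassage, passage] at h

/-- Since `L` is arbitrary, the linear rate of decay is as large as one likes. -/
theorem eventually_measureReal_passage_floor_le_le_exp {p : PosSeq × PosSeq} {q : ℕ} (hq : 0 < q)
    {s t r y δ : ℝ} (hr : q * r < y) (hδ : 0 < δ)
    (h : ∀ L : ℕ, ∀ᶠ N : ℕ in atTop,
      expArray.real {e | passage p e (N * ⌊q * s⌋₊) ((N + L) * ⌊q * t⌋₊) ≤ N * y}
        ≤ Real.exp (-(L * (N * δ)))) (C : ℝ) :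
    ∀ᶠ n : ℕ in atTop,
      expArray.real {e | passage p e ⌊n * s⌋₊ ⌊n * t⌋₊ ≤ n * r} ≤ Real.exp (-(C * n)) := by
  have hq' : (0 : ℝ) < q := Nat.cast_pos.2 hq
  obtain ⟨L, hL⟩ := exists_nat_gt (C * q / δ)
  rw [div_lt_iff₀ hδ] at hL
  have h_div : Tendsto (fun n => n / q) atTop atTop := Nat.tendsto_div_const_atTop hq.ne'
  have h_ratio : Tendsto (fun n : ℕ => ((n / q - L : ℕ) : ℝ) / n) atTop (𝓝 (q : ℝ)⁻¹) := by
    have h_lim := (tendsto_natCast_natDiv_div q).sub (tendsto_const_div_atTop_nhds_zero_nat (L : ℝ))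
    rw [sub_zero] at h_lim
    refine h_lim.congr' ?_
    filter_upwards [h_div.eventually_ge_atTop L] with n hn
    rw [Nat.cast_sub hn, sub_div]
  have h_level : ∀ᶠ n : ℕ in atTop, r < ((n / q - L : ℕ) : ℝ) / n * y :=
    (h_ratio.mul_const y).eventually_const_lt (by rwa [inv_mul_eq_div, lt_div_iff₀' hq'])
  have h_rate : ∀ᶠ n : ℕ in atTop, C < ((n / q - L : ℕ) : ℝ) / n * (L * δ) :=
    (h_ratio.mul_const _).eventually_const_lt (by rwa [inv_mul_eq_div, lt_div_iff₀ hq'])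
  filter_upwards [((tendsto_sub_atTop_nat L).comp h_div).eventually (h L), h_level, h_rate,
    h_div.eventually_ge_atTop L, eventually_gt_atTop 0] with n h_tail h_level h_rate hnL hn
  have hn' : (0 : ℝ) < n := Nat.cast_pos.2 hn
  rw [div_mul_eq_mul_div, lt_div_iff₀ hn'] at h_level h_rate
  simp only [Function.comp_apply, Nat.sub_add_cancel hnL] at h_tail
  refine (measureReal_mono fun e he => ?_).trans (h_tail.trans (Real.exp_le_exp.2 ?_))
  · calc _ ≤ passage p e ⌊n * s⌋₊ ⌊n * t⌋₊ := passage_mono p e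
          ((Nat.mul_le_mul_right _ (Nat.sub_le _ _)).trans (natDiv_mul_floor_le n q s))
          (natDiv_mul_floor_le n q t)
      _ ≤ n * r := he
      _ ≤ _ := by linarith
  · linarith

variable [IsProbabilityMeasure μ]
  (hμ : ∀ k l : ℕ, 0 < k → 0 < l → Ergodic (shiftPair k l) μ)
include hμ

theorem ae_eventually_mul_lt_sum_laplaceGap {θ : ℝ} (hθ : 0 ≤ θ) {k l : ℕ} (hk : 0 < k)
    (hl : 0 < l) {η : ℝ} (hη : η < ∫ p, laplaceGap θ k l p ∂μ) (j : ℕ) :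
    ∀ᵐ p ∂μ, ∀ᶠ N : ℕ in atTop,
      N * η < ∑ i ∈ Finset.range N, laplaceGap θ k l (shiftPair (i * k) ((i + j) * l) p) := by
  have h_birkhoff := ae_eventually_mul_lt_birkhoffSum (hμ k l hk hl) (measurable_laplaceGap θ k l)
    (integrable_laplaceGap μ hθ k l) (laplaceGap_le_one hθ k l) hη
  have h_shift := measurePreserving_shiftPair (fun k l hk hl => (hμ k l hk hl).toMeasurePreserving)
    0 (j * l)
  filter_upwards [h_shift.quasiMeasurePreserving.ae h_birkhoff] with p hp
  simpa only [birkhoffSum, iterate_shiftPair, shiftPair_shiftPair, add_zero, ← add_mul] using hp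

theorem exists_ae_eventually_measureReal_passage_le_le_exp {k l : ℕ} {y : ℝ} (hy0 : 0 ≤ y)
    (hy : y < meanPassage μ k l) : ∃ δ > 0, ∀ᵐ p ∂μ, ∀ L : ℕ, ∀ᶠ N : ℕ in atTop,
      expArray.real {e | passage p e (N * k) ((N + L) * l) ≤ N * y}
        ≤ Real.exp (-(L * (N * δ))) := by
  obtain ⟨hk, hl⟩ := pos_of_meanPassage_pos (hy0.trans_lt hy)
  have h_integrable : Integrable (fun x : (PosSeq × PosSeq) × (ℕ × ℕ → ℝ) => passage x.1 x.2 k l)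
      (μ.prod expArray) := .of_integral_ne_zero (hy0.trans_lt hy).ne'
  obtain ⟨θ, hyθ, hθ : 0 < θ⟩ :=
    (((tendsto_inv_mul_integral_one_sub_exp_neg_mul (fun _ => passage_nonneg _ _ k l)
      h_integrable).eventually_const_lt hy).and self_mem_nhdsWithin).exists
  rw [← integral_laplaceGap μ hθ.le, lt_inv_mul_iff₀ hθ] at hyθ
  obtain ⟨η, hyη, hη⟩ := exists_between hyθ
  refine ⟨η - θ * y, sub_pos.2 hyη, ?_⟩
  filter_upwards [ae_all_iff.2 (ae_eventually_mul_lt_sum_laplaceGap hμ hθ.le hk hl hη)] with p hp L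
  filter_upwards [(Finset.range L).eventually_all.2 fun _ _ => hp _] with N hN
  refine (measureReal_passage_le_le_exp p hθ.le k l N L _).trans (Real.exp_le_exp.2 ?_)
  calc _ ≤ ∑ _ ∈ Finset.range L, -(N * (η - θ * y)) :=
        Finset.sum_le_sum fun _ hj => by linarith [hN _ hj]
    _ = -(L * (N * (η - θ * y))) := by simp

theorem ae_forall_eventually_passage_floor_le_le_exp : ∀ᵐ p ∂μ, ∀ s t r : ℝ, r < shape μ s t →
    ∀ C : ℝ, ∀ᶠ n : ℕ in atTop,
      expArray {e | passage p e ⌊n * s⌋₊ ⌊n * t⌋₊ ≤ n * r}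
        ≤ ENNReal.ofReal (Real.exp (-(C * n))) := by
  have h_blocks : ∀ᵐ p ∂μ, ∀ (k l : ℕ) (y : ℚ), 0 ≤ (y : ℝ) → y < meanPassage μ k l →
      ∃ δ > 0, ∀ L : ℕ, ∀ᶠ N : ℕ in atTop,
        expArray.real {e | passage p e (N * k) ((N + L) * l) ≤ N * y}
          ≤ Real.exp (-(L * (N * δ))) := by
    simp only [ae_all_iff]
    intro k l y hy0 hy
    obtain ⟨δ, hδ, h⟩ := exists_ae_eventually_measureReal_passage_le_le_exp hμ hy0 hy
    exact h.mono fun p hp => ⟨δ, hδ, hp⟩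
  filter_upwards [h_blocks] with p hp s t r hr C
  rcases lt_or_ge r 0 with hr0 | hr0
  · filter_upwards [eventually_gt_atTop 0] with n hn
    have h_empty : {e | passage p e ⌊n * s⌋₊ ⌊n * t⌋₊ ≤ n * r} = ∅ :=
      Set.eq_empty_of_forall_notMem fun e he =>
        (mul_neg_of_pos_of_neg (Nat.cast_pos.2 hn) hr0).not_ge ((passage_nonneg p e _ _).trans he)
    rw [h_empty, measure_empty]
    exact zero_le
  · obtain ⟨q, hq⟩ := exists_lt_of_lt_ciSup hr
    have hq0 : 0 < q := Nat.pos_of_ne_zero fun h => by simp [h, hr0.not_gt] at hq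
    rw [lt_div_iff₀' (Nat.cast_pos.2 hq0)] at hq
    obtain ⟨y, hry, hy⟩ := exists_rat_btwn hq
    obtain ⟨δ, hδ, h⟩ := hp _ _ y ((by positivity : (0 : ℝ) ≤ q * r).trans hry.le) hy
    filter_upwards [eventually_measureReal_passage_floor_le_le_exp hq0 hry hδ h C] with n hn
    exact (ENNReal.le_ofReal_iff_toReal_le (measure_ne_top _ _) (Real.exp_pos _).le).2 hn

theorem ae_eventually_lt_passage_div {s t r : ℝ} (hr : r < shape μ s t) :
    ∀ᵐ x ∂μ.prod expArray, ∀ᶠ n : ℕ in atTop, r < passage x.1 x.2 ⌊n * s⌋₊ ⌊n * t⌋₊ / n := by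
  have h_meas : MeasurableSet {x : (PosSeq × PosSeq) × (ℕ × ℕ → ℝ) |
      ∀ᶠ n : ℕ in atTop, r < passage x.1 x.2 ⌊n * s⌋₊ ⌊n * t⌋₊ / n} := by
    simp only [eventually_atTop, Set.ofPred_exists, Set.ofPred_forall]
    exact .iUnion fun _ => .iInter fun n => .iInter fun _ =>
      measurableSet_lt measurable_const (by fun_prop)
  rw [Measure.ae_prod_iff_ae_ae h_meas]
  filter_upwards [ae_forall_eventually_passage_floor_le_le_exp hμ] with p hp
  filter_upwards [ae_eventually_notMem_of_le_exp (by simpa using hp s t r hr 1)] with e he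
  filter_upwards [he, eventually_gt_atTop 0] with n hn hn0
  rw [lt_div_iff₀' (Nat.cast_pos.2 hn0)]
  exact not_le.1 hn

end LowerTail

section Limit

variable {μ : Measure (PosSeq × PosSeq)}

theorem ae_essInf_add_essInf_le_rate
    (hμ : ∀ k l : ℕ, 0 < k → 0 < l → MeasurePreserving (shiftPair k l) μ μ) :
    ∀ᵐ p ∂μ, ∀ i j : ℕ, essInf (fun p : PosSeq × PosSeq => (p.1 0 : ℝ)) μ
      + essInf (fun p : PosSeq × PosSeq => (p.2 0 : ℝ)) μ ≤ (p.1 i : ℝ) + (p.2 j : ℝ) := by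
  have h_fst : ∀ᵐ p ∂μ, essInf (fun p : PosSeq × PosSeq => (p.1 0 : ℝ)) μ ≤ (p.1 0 : ℝ) :=
    ae_essInf_le (isBoundedUnder_of ⟨0, fun p => (p.1 0).2.le⟩)
  have h_snd : ∀ᵐ p ∂μ, essInf (fun p : PosSeq × PosSeq => (p.2 0 : ℝ)) μ ≤ (p.2 0 : ℝ) :=
    ae_essInf_le (isBoundedUnder_of ⟨0, fun p => (p.2 0).2.le⟩)
  simp only [ae_all_iff]
  intro i j
  filter_upwards [(measurePreserving_shiftPair hμ i j).quasiMeasurePreserving.ae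
    (h_fst.and h_snd)] with p hp
  simpa only [shiftPair, shift, Prod.map_fst, Prod.map_snd, zero_add] using add_le_add hp.1 hp.2

theorem eventually_passage_floor_div_lt {p : PosSeq × PosSeq} {e : ℕ × ℕ → ℝ} {q : ℕ} (hq : 0 < q)
    {s t r y : ℝ} (hy : y < q * r)
    (h : ∀ᶠ N : ℕ in atTop, passage p e (N * ⌈q * s⌉₊) (N * ⌈q * t⌉₊) < N * y) :
    ∀ᶠ n : ℕ in atTop, passage p e ⌊n * s⌋₊ ⌊n * t⌋₊ / n < r := by
  have h_ratio : Tendsto (fun n : ℕ => ((n / q + 1 : ℕ) : ℝ) / n) atTop (𝓝 (q : ℝ)⁻¹) := by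
    have h_lim := (tendsto_natCast_natDiv_div q).add tendsto_one_div_atTop_nhds_zero_nat
    simpa only [Nat.cast_add, Nat.cast_one, add_div, add_zero] using h_lim
  have h_level : ∀ᶠ n : ℕ in atTop, ((n / q + 1 : ℕ) : ℝ) / n * y < r :=
    (h_ratio.mul_const y).eventually_lt_const
      (by rwa [inv_mul_eq_div, div_lt_iff₀' (Nat.cast_pos.2 hq)])
  filter_upwards [((tendsto_add_atTop_nat 1).comp
    (Nat.tendsto_div_const_atTop hq.ne')).eventually h, h_level, eventually_gt_atTop 0]
    with n h_block h_level hn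
  have hn' : (0 : ℝ) < n := Nat.cast_pos.2 hn
  rw [div_mul_eq_mul_div, div_lt_iff₀ hn'] at h_level
  rw [div_lt_iff₀ hn']
  calc passage p e ⌊n * s⌋₊ ⌊n * t⌋₊
      ≤ passage p e ((n / q + 1) * ⌈q * s⌉₊) ((n / q + 1) * ⌈q * t⌉₊) :=
        passage_mono p e (floor_le_natDiv_add_one_mul_ceil hq n s)
          (floor_le_natDiv_add_one_mul_ceil hq n t)
    _ < (n / q + 1 : ℕ) * y := h_block
    _ < r * n := h_level

theorem shape_nonneg (s t : ℝ) : 0 ≤ shape μ s t :=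
  Real.iSup_nonneg fun q =>
    div_nonneg (integral_nonneg fun x => passage_nonneg x.1 x.2 _ _) q.cast_nonneg

variable [IsProbabilityMeasure μ] {c : ℝ} (hc : 0 < c)
  (h_rate : ∀ᵐ p ∂μ, ∀ i j : ℕ, c ≤ (p.1 i : ℝ) + (p.2 j : ℝ))
include hc h_rate

theorem lintegral_exp_mul_passage_le (m n : ℕ) :
    ∫⁻ x, ENNReal.ofReal (Real.exp (c / 2 * passage x.1 x.2 m n)) ∂μ.prod expArray
      ≤ 4 ^ (m + n) := by
  rw [lintegral_prod _ (by fun_prop)]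
  refine (lintegral_mono_ae (g := fun _ => 4 ^ (m + n)) ?_).trans_eq (by simp)
  filter_upwards [h_rate] with p hp
  have h_weight (ij : ℕ × ℕ) : ∫⁻ x, ENNReal.ofReal (Real.exp (c / 2 * x))
      ∂expMeasure ((p.1 ij.1 : ℝ) + (p.2 ij.2 : ℝ)) ≤ 2 := by
    have h_le := hp ij.1 ij.2
    rw [lintegral_exp_mul_expMeasure (rate_pos p _ _) (by linarith), ENNReal.ofReal_le_ofNat,
      div_le_iff₀ (by linarith)]
    linarith
  have h_quenched : ∫⁻ w, ENNReal.ofReal (Real.exp (c / 2 * lastPassage w m n)) ∂quenched p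
      ≤ (2 * 2) ^ (m + n) := lintegral_exp_mul_lastPassage_le _ one_le_two h_weight m n
  rw [← map_weight, lintegral_map (by fun_prop) (by fun_prop)] at h_quenched
  exact h_quenched.trans_eq (by norm_num)

theorem integrable_passage (m n : ℕ) :
    Integrable (fun x => passage x.1 x.2 m n) (μ.prod expArray) :=
  integrable_of_lintegral_exp_mul_ne_top (measurable_passage m n)
    (fun x => passage_nonneg x.1 x.2 m n) (half_pos hc)
    (ne_top_of_le_ne_top (by finiteness) (lintegral_exp_mul_passage_le hc h_rate m n))

theorem meanPassage_mono {m m' n n' : ℕ} (hm : m ≤ m') (hn : n ≤ n') :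
    meanPassage μ m n ≤ meanPassage μ m' n' :=
  integral_mono (integrable_passage hc h_rate m n) (integrable_passage hc h_rate m' n')
    fun x => passage_mono x.1 x.2 hm hn

theorem meanPassage_le (m n : ℕ) : meanPassage μ m n ≤ 2 / c * Real.log 4 * (m + n) := by
  have h_exp := (ofReal_exp_integral_le_lintegral
    ((integrable_passage hc h_rate m n).const_mul (c / 2))).trans
    (lintegral_exp_mul_passage_le hc h_rate m n)
  have h_four : (4 : ENNReal) ^ (m + n) = ENNReal.ofReal (4 ^ (m + n)) := by
    rw [ENNReal.ofReal_pow zero_le_four, ENNReal.ofReal_ofNat]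
  rw [h_four, ENNReal.ofReal_le_ofReal_iff (by positivity),
    ← Real.le_log_iff_exp_le (by positivity), integral_const_mul, Real.log_pow,
    Nat.cast_add] at h_exp
  change c / 2 * meanPassage μ m n ≤ _ at h_exp
  field_simp
  linarith

theorem bddAbove_range_meanPassage_floor_div (s t : ℝ) :
    BddAbove (Set.range fun q : ℕ => meanPassage μ ⌊q * s⌋₊ ⌊q * t⌋₊ / q) := by
  have h_floor (q : ℕ) (s : ℝ) : (⌊q * s⌋₊ : ℝ) ≤ q * |s| :=
    (Nat.cast_le.2 (Nat.floor_le_floor (by gcongr; exact le_abs_self s))).trans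
      (Nat.floor_le (by positivity))
  refine ⟨2 / c * Real.log 4 * (|s| + |t|), ?_⟩
  rintro _ ⟨q, rfl⟩
  refine div_le_of_le_mul₀ q.cast_nonneg (by positivity) ?_
  calc meanPassage μ ⌊q * s⌋₊ ⌊q * t⌋₊
      ≤ 2 / c * Real.log 4 * (⌊q * s⌋₊ + ⌊q * t⌋₊) := meanPassage_le hc h_rate _ _
    _ ≤ 2 / c * Real.log 4 * (q * |s| + q * |t|) := by gcongr <;> exact h_floor _ _
    _ = 2 / c * Real.log 4 * (|s| + |t|) * q := by ring

theorem meanPassage_floor_le_mul_shape (q : ℕ) (s t : ℝ) :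
    meanPassage μ ⌊q * s⌋₊ ⌊q * t⌋₊ ≤ q * shape μ s t := by
  rcases q.eq_zero_or_pos with rfl | hq
  · simp [meanPassage, passage]
  · rw [← div_le_iff₀' (Nat.cast_pos.2 hq)]
    exact le_ciSup (bddAbove_range_meanPassage_floor_div hc h_rate s t) q

theorem shape_le_mul_shape {q : ℕ} {s t s' t' : ℝ} (hs : s' ≤ q * s) (ht : t' ≤ q * t) :
    shape μ s' t' ≤ q * shape μ s t := by
  refine ciSup_le fun m => div_le_of_le_mul₀ m.cast_nonneg
    (mul_nonneg q.cast_nonneg (shape_nonneg s t)) ?_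
  have h_floor {s s' : ℝ} (hs : s' ≤ q * s) : ⌊m * s'⌋₊ ≤ ⌊(m * q : ℕ) * s⌋₊ := by
    rw [Nat.cast_mul, mul_assoc]
    gcongr
  calc meanPassage μ ⌊m * s'⌋₊ ⌊m * t'⌋₊
      ≤ meanPassage μ ⌊(m * q : ℕ) * s⌋₊ ⌊(m * q : ℕ) * t⌋₊ :=
        meanPassage_mono hc h_rate (h_floor hs) (h_floor ht)
    _ ≤ (m * q : ℕ) * shape μ s t := meanPassage_floor_le_mul_shape hc h_rate _ _ _
    _ = q * shape μ s t * m := by push_cast; ring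

theorem exists_shape_ceil_lt_mul {s t r : ℝ} (hs : 0 < s) (ht : 0 < t) (hr : shape μ s t < r) :
    ∃ q : ℕ, 0 < q ∧ shape μ ⌈q * s⌉₊ ⌈q * t⌉₊ < q * r := by
  obtain ⟨a, ha⟩ := exists_nat_ge (max s⁻¹ t⁻¹)
  obtain ⟨q, hq⟩ := exists_nat_gt (a * shape μ s t / (r - shape μ s t))
  rw [div_lt_iff₀ (sub_pos.2 hr)] at hq
  have h_ceil {s : ℝ} (hs : 0 < s) (ha : s⁻¹ ≤ a) : (⌈q * s⌉₊ : ℝ) ≤ (q + a : ℕ) * s := by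
    rw [inv_le_iff_one_le_mul₀ hs] at ha
    push_cast
    linarith [Nat.ceil_lt_add_one (a := q * s) (by positivity)]
  have h_shape := shape_le_mul_shape hc h_rate (h_ceil hs ((le_max_left _ _).trans ha))
    (h_ceil ht ((le_max_right _ _).trans ha))
  refine ⟨q, Nat.pos_of_ne_zero ?_, h_shape.trans_lt ?_⟩
  · rintro rfl
    rw [Nat.cast_zero, zero_mul] at hq
    exact hq.not_ge (mul_nonneg a.cast_nonneg (shape_nonneg s t))
  · push_cast
    linarith

variable (hμ : ∀ k l : ℕ, 0 < k → 0 < l → Ergodic (shiftPair k l) μ)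
include hμ

theorem ae_upperRate_passage_le (k l : ℕ) : ∀ᵐ x ∂μ.prod expArray,
    upperRate (fun n x => passage x.1 x.2 (n * k) (n * l)) x ≤ shape μ k l := by
  have h_superadditive : IsNonnegSuperadditive (Prod.map (shiftPair k l) (translate k l))
      fun n x => passage x.1 x.2 (n * k) (n * l) :=
    { nonneg := fun n x => passage_nonneg _ _ _ _
      add_le := fun m n x => by
        rw [Prod.map_iterate, iterate_shiftPair, iterate_translate, add_mul, add_mul]
        exact lastPassage_add_le (weight_nonneg x.1 x.2) _ _ _ _ }
  have h_floor (n k : ℕ) : ⌊(n * k : ℝ)⌋₊ = n * k := by exact_mod_cast Nat.floor_natCast (n * k)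
  have h_map := (measurePreserving_shiftPair
    (fun k l hk hl => (hμ k l hk hl).toMeasurePreserving) k l).prod
      (measurePreserving_translate k l)
  refine h_superadditive.ae_upperRate_le_of_forall_lt h_map (fun n => measurable_passage _ _)
    (fun n => integrable_passage hc h_rate _ _) (fun n => ?_) fun r hr => ?_
  · simpa only [h_floor, meanPassage] using meanPassage_floor_le_mul_shape hc h_rate n k l
  · filter_upwards [ae_eventually_lt_passage_div hμ hr] with x hx
    obtain ⟨n, hn, hn0⟩ := (hx.and (eventually_gt_atTop 0)).exists
    rw [h_floor, h_floor, lt_div_iff₀' (Nat.cast_pos.2 hn0)] at hn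
    exact ⟨n, hn0, hn.le⟩

theorem ae_eventually_passage_div_lt {s t r : ℝ} (hs : 0 < s) (ht : 0 < t)
    (hr : shape μ s t < r) :
    ∀ᵐ x ∂μ.prod expArray, ∀ᶠ n : ℕ in atTop, passage x.1 x.2 ⌊n * s⌋₊ ⌊n * t⌋₊ / n < r := by
  obtain ⟨q, hq, h_lt⟩ := exists_shape_ceil_lt_mul hc h_rate hs ht hr
  obtain ⟨y, h_shape, hy⟩ := exists_between h_lt
  filter_upwards [ae_upperRate_passage_le hc h_rate hμ ⌈q * s⌉₊ ⌈q * t⌉₊] with x hx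
  exact eventually_passage_floor_div_lt hq hy
    (eventually_lt_mul_of_upperRate_lt (hx.trans_lt (EReal.coe_lt_coe_iff.2 h_shape)))

theorem isShapeFunction_shape : IsShapeFunction μ (shape μ) := by
  intro s t hs ht
  have h_tendsto : ∀ᵐ x ∂μ.prod expArray,
      Tendsto (fun n : ℕ => passage x.1 x.2 ⌊n * s⌋₊ ⌊n * t⌋₊ / n) atTop (𝓝 (shape μ s t)) :=
    ae_tendsto_of_forall_ae_eventually (fun r => ae_eventually_lt_passage_div hμ)
      fun r => ae_eventually_passage_div_lt hc h_rate hμ hs ht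
  filter_upwards [Measure.ae_ae_of_ae_prod h_tendsto] with p hp
  rw [← map_weight, ae_map_iff (measurable_weight_right p).aemeasurable
    (measurableSet_tendsto _ fun n => (measurable_lastPassage _ _).div_const _)]
  exact hp

end Limit

end CornerGrowth

end

theorem mainTheorem8_general
    (μ : Measure (CornerGrowth.PosSeq × CornerGrowth.PosSeq)) [IsProbabilityMeasure μ]
    (h_ergodic : ∀ k l : ℕ, 0 < k → 0 < l →
      Ergodic (Prod.map (CornerGrowth.shift k) (CornerGrowth.shift l)) μ)
    (h_essInf : 0 <
      essInf (fun p : CornerGrowth.PosSeq × CornerGrowth.PosSeq => (p.1 0 : ℝ)) μ +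
        essInf (fun p : CornerGrowth.PosSeq × CornerGrowth.PosSeq => (p.2 0 : ℝ)) μ) :
    ∃ g : ℝ → ℝ → ℝ, CornerGrowth.IsShapeFunction μ g ∧
      ∀ᵐ p ∂μ, ∀ s t r : ℝ, 0 < s → 0 < t → r < g s t →
        Tendsto
          (fun n : ℕ => -(((1 / (n : ℝ) : ℝ) : EReal) *
            ENNReal.log (CornerGrowth.quenched p
              {w | CornerGrowth.lastPassage w ⌊(n : ℝ) * s⌋₊ ⌊(n : ℝ) * t⌋₊ ≤ (n : ℝ) * r})))
          atTop (𝓝 (⊤ : EReal)) := by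
  have h_rate := CornerGrowth.ae_essInf_add_essInf_le_rate
    fun k l hk hl => (h_ergodic k l hk hl).toMeasurePreserving
  refine ⟨CornerGrowth.shape μ, CornerGrowth.isShapeFunction_shape h_essInf h_rate h_ergodic, ?_⟩
  filter_upwards [CornerGrowth.ae_forall_eventually_passage_floor_le_le_exp h_ergodic]
    with p h_tail s t r _ _ hr
  simp only [CornerGrowth.quenched_lastPassage_le]
  exact tendsto_neg_inv_mul_log_top (h_tail s t r hr)

theorem mainTheorem8
    (μ : Measure (CornerGrowth.PosSeq × CornerGrowth.PosSeq)) [IsProbabilityMeasure μ]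
    (h_ergodic : ∀ k l : ℕ, 0 < k → 0 < l →
      Ergodic (Prod.map (CornerGrowth.shift k) (CornerGrowth.shift l)) μ)
    (h_integrable : Integrable
      (fun p : CornerGrowth.PosSeq × CornerGrowth.PosSeq => (p.1 0 : ℝ) + (p.2 0 : ℝ)) μ)
    (h_essInf : 0 <
      essInf (fun p : CornerGrowth.PosSeq × CornerGrowth.PosSeq => (p.1 0 : ℝ)) μ +
        essInf (fun p : CornerGrowth.PosSeq × CornerGrowth.PosSeq => (p.2 0 : ℝ)) μ) :
    ∃ g : ℝ → ℝ → ℝ, CornerGrowth.IsShapeFunction μ g ∧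
      ∀ᵐ p ∂μ, ∀ s t r : ℝ, 0 < s → 0 < t → r < g s t →
        Tendsto
          (fun n : ℕ => -(((1 / (n : ℝ) : ℝ) : EReal) *
            ENNReal.log (CornerGrowth.quenched p
              {w | CornerGrowth.lastPassage w ⌊(n : ℝ) * s⌋₊ ⌊(n : ℝ) * t⌋₊ ≤ (n : ℝ) * r})))
          atTop (𝓝 (⊤ : EReal)) :=
  mainTheorem8_general μ h_ergodic h_essInf
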